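/- Let $E=\{\lambda\in\mathbb C:|\lambda|<1\}$, $m(\lambda_1,\lambda_2)=\frac{|\lambda_1-\lambda_2|}{|1-\bar\lambda_1\lambda_2|}$ for $\lambda_1,\lambda_2\in E$, and, for a domain $D\subset\mathbb C^n$, let $\mathcal O(E,D)$ be the set of holomorphic mappings $E\to D$. The Lempert function of $D$ is $$\tilde k_D^*(w,z)=\inf\{m(\lambda_1,\lambda_2):\lambda_1,\lambda_2\in E,\ \exists\,\varphi\in\mathcal O(E,D),\ \varphi(\lambda_1)=w,\ \varphi(\lambda_2)=z\},$$ and $\varphi\in\mathcal O(E,D)$ is called a $\tilde k_D$-geodesic for $(w,z)$, $w\ne z$, if there are $\lambda_1,\lambda_2\in E$ with $\varphi(\lambda_1)=w$, $\varphi(\lambda_2)=z$ and $m(\lambda_1,\lambda_2)=\tilde k_D^*(w,z)$. The domain $D$ is taut if every sequence in $\mathcal O(E,D)$ has a subsequence that either converges locally uniformly on $E$ to an element of $\mathcal O(E,D)$, or is compactly divergent (for all compact $K\subset E$ and $L\subset D$, all but finitely many of its members map $K$ into $D\setminus L$). Let $n\ge 2$, let $\alpha=(\alpha_1,\dots,\alpha_n)$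 be positive integers with $\gcd(\alpha_1,\dots,\alpha_n)=1$, put $z^\alpha=z_1^{\alpha_1}\cdots z_n^{\alpha_n}$ and $$D_\alpha=\{z\in\mathbb C^n:|z_1|^{\alpha_1}\cdots|z_n|^{\alpha_n}<1\}.$$ Let $w,z\in D_\alpha$ satisfy $w_1\cdots w_n\ne0$, $z_1\cdots z_n\neq 0$ and $w^\alpha\ne z^\alpha$. Then there is a $\tilde k_{D_\alpha}$-geodesic $\varphi\in\mathcal O(E,D_\alpha)$ for $(w,z)$ that is bounded, i.e. $\varphi(E)$ is a bounded subset of $\mathbb C^n$. Moreover, $D_\alpha$ is not taut. -/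

import Mathlib

noncomputable section

namespace Lempert

/-- The open unit disc `E` in `ℂ`. -/
def unitDisc : Set ℂ := Metric.ball 0 1

/-- The Möbius distance `m(a, b) = |a - b| / |1 - ā b|` (used for `a, b` in the unit disc). -/
def mobiusDist (a b : ℂ) : ℝ := ‖a - b‖ / ‖1 - (starRingEnd ℂ) a * b‖

/-- `𝒪(E, D)`: the holomorphic mappings of the unit disc into `D ⊆ ℂⁿ` (analytic discs in `D`).
Values outside the unit disc are irrelevant. -/
def IsAnalyticDisc {n : ℕ} (D : Set (Fin n → ℂ)) (φ : ℂ → Fin n → ℂ) : Prop :=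
  DifferentiableOn ℂ φ unitDisc ∧ Set.MapsTo φ unitDisc D

/-- The Lempert function `k̃*_D(w, z) = inf m(a, b)`, over all `a, b` in the unit disc for which
some `φ ∈ 𝒪(E, D)` has `φ a = w` and `φ b = z`. -/
def lempertFunction {n : ℕ} (D : Set (Fin n → ℂ)) (w z : Fin n → ℂ) : ℝ :=
  sInf {r : ℝ | ∃ a ∈ unitDisc, ∃ b ∈ unitDisc, r = mobiusDist a b ∧
    ∃ φ : ℂ → Fin n → ℂ, IsAnalyticDisc D φ ∧ φ a = w ∧ φ b = z}

/-- `φ ∈ 𝒪(E, D)` is a `k̃_D`-geodesic for `(w, z)`, `w ≠ z`: it passes through `w` and `z` at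
points of the disc whose Möbius distance is the value of the Lempert function. -/
def IsLempertGeodesic {n : ℕ} (D : Set (Fin n → ℂ)) (w z : Fin n → ℂ)
    (φ : ℂ → Fin n → ℂ) : Prop :=
  w ≠ z ∧ IsAnalyticDisc D φ ∧
    ∃ a ∈ unitDisc, ∃ b ∈ unitDisc, φ a = w ∧ φ b = z ∧ mobiusDist a b = lempertFunction D w z

/-- `D` is taut: every sequence in `𝒪(E, D)` has a subsequence that converges locally uniformly
on the disc to an element of `𝒪(E, D)`, or one that is compactly divergent. -/
def IsTaut {n : ℕ} (D : Set (Fin n → ℂ)) : Prop :=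
  ∀ φ : ℕ → ℂ → Fin n → ℂ, (∀ k, IsAnalyticDisc D (φ k)) →
    ∃ s : ℕ → ℕ, StrictMono s ∧
      ((∃ ψ : ℂ → Fin n → ℂ, IsAnalyticDisc D ψ ∧
          TendstoLocallyUniformlyOn (fun k => φ (s k)) ψ Filter.atTop unitDisc) ∨
        (∀ K : Set ℂ, K ⊆ unitDisc → IsCompact K → ∀ L : Set (Fin n → ℂ), L ⊆ D → IsCompact L →
          ∀ᶠ k in Filter.atTop, Disjoint (φ (s k) '' K) L))

/-- The monomial `z^α = z₁^α₁ ⋯ zₙ^αₙ`. -/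
def monomial {n : ℕ} (α : Fin n → ℕ) (z : Fin n → ℂ) : ℂ := ∏ j, z j ^ α j

/-- The elementary Reinhardt domain `D_α = {z ∈ ℂⁿ : |z₁|^α₁ ⋯ |zₙ|^αₙ < 1}`. -/
def reinhardtDomain {n : ℕ} (α : Fin n → ℕ) : Set (Fin n → ℂ) := {z | ∏ j, ‖z j‖ ^ α j < 1}

/-- The points of `D_α` with `z₁ ⋯ zₙ ≠ 0`. -/
def reinhardtDomainStar {n : ℕ} (α : Fin n → ℕ) : Set (Fin n → ℂ) :=
  {z | z ∈ reinhardtDomain α ∧ ∏ j, z j ≠ 0}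

end Lempert

end

/-!
A bounded geodesic exists because the extremal problem behind the Lempert function of `D_α` only
depends on finitely many numbers. Let `φ` be an analytic disc in `D_α`, holomorphic up to the
boundary, and factor each coordinate as `φ j = B j * exp (g j)` with `B j` a finite Blaschke product
(`exists_inner_factorization`, `exists_log_unitDisc`). On the unit circle `|B j| = 1`, so by the
maximum principle `u = ∑ j, α j * g j` maps the disc into the closed left half-plane. The values of
the `B j` and of `u` at two points of Möbius distance `s` therefore satisfy Schwarz–Pick
inequalities, and they determine `φ ^ α = exp u * ∏ j, B j ^ α j` at these points; such a set of
values is a `PickData`.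

Conversely, values satisfying the Schwarz–Pick inequalities are attained by explicit maps at `0` and
`s` (`exists_interpolation`, `exists_interpolation_of_re_nonpos`). From such `B j` and `u` one gets
back a disc `B j * exp (L j + M j * x + u x / ∑ k, α k)` through `w` and `z`, with constants `L j`
and `M j` whose weighted sums vanish. Since the `α j` are coprime, the logarithms needed for this
exist (`exists_logs`), and the disc is bounded as `Re u ≤ 0` (`PickData.exists_bounded_disc`).

Interpolation data with given `w ^ α ≠ z ^ α` and `s` bounded away from `1` are compact modulo
`2πi`, so there is a smallest `s` (`exists_minimal_pickData`). It is the value of the Lempert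
function: a disc that is not holomorphic up to the boundary is restricted to radius `ρ < 1`, and
`ρ` tends to `1`.

The domain is not taut because it contains the discs `x ↦ (k x, 0, …, 0)`.
-/

open Complex Metric Set Filter Topology

namespace Lempert

local notation "conj" => starRingEnd ℂ

variable {n : ℕ}

/-! ### Two-point Schwarz–Pick lemmas and their converses -/

theorem mem_unitDisc {x : ℂ} : x ∈ unitDisc ↔ ‖x‖ < 1 := by
  simp [unitDisc]

theorem sq_norm_one_sub_conj_mul_sub (p q : ℂ) :
    ‖1 - conj p * q‖ ^ 2 - ‖p - q‖ ^ 2 = (1 - ‖p‖ ^ 2) * (1 - ‖q‖ ^ 2) := by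
  simp only [← Complex.normSq_eq_norm_sq, Complex.normSq_apply]
  simp
  ring

theorem one_sub_conj_mul_ne_zero {p q : ℂ} (hp : ‖p‖ < 1) (hq : ‖q‖ ≤ 1) :
    1 - conj p * q ≠ 0 := by
  intro h
  have h1 : ‖conj p * q‖ = 1 := by rw [← sub_eq_zero.mp h]; simp
  rw [norm_mul, RCLike.norm_conj] at h1
  nlinarith [norm_nonneg p, norm_nonneg q]

theorem norm_sub_lt_norm_one_sub_conj_mul {p q : ℂ} (hp : ‖p‖ < 1) (hq : ‖q‖ < 1) :
    ‖p - q‖ < ‖1 - conj p * q‖ := by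
  have h := sq_norm_one_sub_conj_mul_sub p q
  have h1 : ‖p‖ ^ 2 < 1 := pow_lt_one₀ (norm_nonneg _) hp (by norm_num)
  have h2 : ‖q‖ ^ 2 < 1 := pow_lt_one₀ (norm_nonneg _) hq (by norm_num)
  refine lt_of_pow_lt_pow_left₀ 2 (norm_nonneg _) ?_
  nlinarith [mul_pos (sub_pos.2 h1) (sub_pos.2 h2)]

/-- Strong maximum principle on the disc, for functions bounded by one. -/
theorem norm_lt_one_or_eq {f : ℂ → ℂ} (hf : DifferentiableOn ℂ f unitDisc)
    (hb : ∀ x ∈ unitDisc, ‖f x‖ ≤ 1) :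
    (∀ x ∈ unitDisc, ‖f x‖ < 1) ∨ ∀ x ∈ unitDisc, ∀ y ∈ unitDisc, f x = f y := by
  by_cases h : ∀ x ∈ unitDisc, ‖f x‖ < 1
  · exact Or.inl h
  right
  push Not at h
  obtain ⟨c, hc, hc1⟩ := h
  have key := Complex.eqOn_of_isPreconnected_of_isMaxOn_norm (f := f)
    (convex_ball (0 : ℂ) 1).isPreconnected isOpen_ball hf hc
    (fun x hx => (hb x hx).trans hc1)
  intro x hx y hy
  exact (key hx).trans (key hy).symm

/-- For `‖a‖ < 1`, the disc automorphism taking `0` to `a`; its inverse is `discShift (-a)`. -/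
noncomputable def discShift (a x : ℂ) : ℂ := (x + a) / (1 + conj a * x)

theorem one_add_conj_mul_ne_zero {p q : ℂ} (hp : ‖p‖ < 1) (hq : ‖q‖ ≤ 1) :
    1 + conj p * q ≠ 0 := by
  simpa using one_sub_conj_mul_ne_zero (p := -p) (q := q) (by simpa using hp) hq

theorem discShift_mapsTo {a : ℂ} (ha : ‖a‖ < 1) : MapsTo (discShift a) unitDisc unitDisc := by
  intro x hx
  rw [mem_unitDisc] at hx ⊢
  have h := norm_sub_lt_norm_one_sub_conj_mul (p := -a) (q := x) (by simpa using ha) hx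
  have h0 := one_add_conj_mul_ne_zero ha hx.le
  rw [discShift, norm_div, div_lt_one (norm_pos_iff.2 h0)]
  rw [← norm_neg] at h
  simpa [add_comm] using h

theorem discShift_differentiableOn {a : ℂ} (ha : ‖a‖ < 1) :
    DifferentiableOn ℂ (discShift a) unitDisc := by
  intro x hx
  have h0 := one_add_conj_mul_ne_zero ha (mem_unitDisc.1 hx).le
  unfold discShift
  exact ((by fun_prop : DifferentiableAt ℂ (fun x : ℂ => x + a) x).fun_div
    (by fun_prop) h0).differentiableWithinAt

theorem discShift_discShift_neg {a x : ℂ} (ha : ‖a‖ < 1) (hx : ‖x‖ ≤ 1) :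
    discShift a (discShift (-a) x) = x := by
  have h0 : 1 - conj a * x ≠ 0 := one_sub_conj_mul_ne_zero ha hx
  have h1 : 1 - conj a * a ≠ 0 := one_sub_conj_mul_ne_zero ha ha.le
  have e : discShift (-a) x = (x - a) / (1 - conj a * x) := by
    simp [discShift, sub_eq_add_neg]
  have h2 : 1 + conj a * discShift (-a) x = (1 - conj a * a) / (1 - conj a * x) := by
    rw [e]; field_simp; ring
  rw [discShift, h2, e, div_eq_iff (div_ne_zero h1 h0), div_add' _ _ _ h0, mul_div_assoc']
  congr 1
  ring

theorem norm_discShift_neg (a b : ℂ) : ‖discShift (-a) b‖ = mobiusDist a b := by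
  rw [discShift, mobiusDist, norm_div, ← norm_neg (b + -a)]
  congr 2 <;> simp [sub_eq_add_neg]

theorem mobiusDist_nonneg (a b : ℂ) : 0 ≤ mobiusDist a b := by
  unfold mobiusDist; positivity

/-- **Schwarz–Pick lemma**, in a multiplied-out form that also covers unimodular constants. -/
theorem norm_sub_le_mobiusDist_mul {f : ℂ → ℂ} (hf : DifferentiableOn ℂ f unitDisc)
    (hb : ∀ x ∈ unitDisc, ‖f x‖ ≤ 1) {a b : ℂ} (ha : a ∈ unitDisc) (hbd : b ∈ unitDisc) :
    ‖f a - f b‖ ≤ mobiusDist a b * ‖1 - conj (f a) * f b‖ := by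
  rcases norm_lt_one_or_eq hf hb with h | h
  · have ha' := mem_unitDisc.1 ha
    have hb' := mem_unitDisc.1 hbd
    have hna : ‖-a‖ < 1 := by simpa using ha'
    have hfa : ‖-f a‖ < 1 := by simpa using h a ha
    have hm : MapsTo f unitDisc unitDisc := fun x hx => mem_unitDisc.2 (h x hx)
    let g : ℂ → ℂ := discShift (-f a) ∘ f ∘ discShift a
    have hgd : DifferentiableOn ℂ g unitDisc :=
      (discShift_differentiableOn hfa).comp
        (hf.comp (discShift_differentiableOn ha') (discShift_mapsTo ha'))
        (hm.comp (discShift_mapsTo ha'))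
    have hgm : MapsTo g unitDisc unitDisc :=
      (discShift_mapsTo hfa).comp (hm.comp (discShift_mapsTo ha'))
    have hg0 : g 0 = 0 := by simp [g, discShift]
    have hlt := discShift_mapsTo hna hbd
    have key := Complex.norm_le_norm_of_mapsTo_ball (f := g) (R := 1) hgd
      (fun x hx => ball_subset_closedBall (hgm hx)) hg0 (mem_unitDisc.1 hlt)
    have e : g (discShift (-a) b) = discShift (-f a) (f b) := by
      simp only [g, Function.comp_apply, discShift_discShift_neg ha' hb'.le]
    rw [e, norm_discShift_neg, norm_discShift_neg] at key
    have h0 := one_sub_conj_mul_ne_zero (h a ha) (h b hbd).le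
    conv_lhs at key => rw [mobiusDist]
    rwa [div_le_iff₀ (norm_pos_iff.2 h0)] at key
  · rw [h a ha b hbd, sub_self, norm_zero]
    exact mul_nonneg (mobiusDist_nonneg _ _) (norm_nonneg _)

/-- The Cayley transform of the closed left half-plane onto the closed disc punctured at `1`. It is
an involution. -/
noncomputable def cayley (u : ℂ) : ℂ := (u + 1) / (u - 1)

theorem ne_one_of_re_nonpos {u : ℂ} (hu : u.re ≤ 0) : u ≠ 1 := by
  rintro rfl
  norm_num at hu

theorem sub_one_ne_zero_of_re_nonpos {u : ℂ} (hu : u.re ≤ 0) : u - 1 ≠ 0 :=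
  sub_ne_zero.2 (ne_one_of_re_nonpos hu)

theorem norm_cayley_le_one {u : ℂ} (hu : u.re ≤ 0) : ‖cayley u‖ ≤ 1 := by
  have h0 := sub_one_ne_zero_of_re_nonpos hu
  rw [cayley, norm_div, div_le_one (norm_pos_iff.2 h0)]
  refine le_of_sq_le_sq ?_ (norm_nonneg _)
  rw [← Complex.normSq_eq_norm_sq, ← Complex.normSq_eq_norm_sq, Complex.normSq_apply,
    Complex.normSq_apply]
  simp
  nlinarith

theorem cayley_ne_one (u : ℂ) : cayley u ≠ 1 := by
  intro h
  unfold cayley at h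
  have h0 : u - 1 ≠ 0 := by
    intro h0
    simp [h0] at h
  rw [div_eq_one_iff_eq h0] at h
  have := congrArg Complex.re h
  simp at this
  linarith

theorem cayley_cayley {u : ℂ} (hu : u ≠ 1) : cayley (cayley u) = u := by
  have h0 : u - 1 ≠ 0 := sub_ne_zero.2 hu
  have h1 : cayley u - 1 = 2 / (u - 1) := by unfold cayley; field_simp; ring
  have h2 : cayley u + 1 = 2 * u / (u - 1) := by unfold cayley; field_simp; ring
  rw [cayley, h1, h2]
  field_simp

theorem cayley_re_nonpos {p : ℂ} (hp : ‖p‖ ≤ 1) : (cayley p).re ≤ 0 := by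
  have h2 : ‖p‖ ^ 2 ≤ 1 := pow_le_one₀ (norm_nonneg _) hp
  rw [← Complex.normSq_eq_norm_sq, Complex.normSq_apply] at h2
  rw [cayley, Complex.div_re, ← add_div]
  refine div_nonpos_of_nonpos_of_nonneg ?_ (Complex.normSq_nonneg _)
  simp
  nlinarith

theorem norm_cayley_sub {P Q : ℂ} (hP : P.re ≤ 0) (hQ : Q.re ≤ 0) :
    ‖cayley P - cayley Q‖ = 2 * ‖P - Q‖ / (‖P - 1‖ * ‖Q - 1‖) := by
  have h1 := sub_one_ne_zero_of_re_nonpos hP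
  have h2 := sub_one_ne_zero_of_re_nonpos hQ
  have : cayley P - cayley Q = -(2 * (P - Q)) / ((P - 1) * (Q - 1)) := by
    unfold cayley; field_simp; ring
  rw [this]
  simp

theorem norm_one_sub_conj_cayley_mul {P Q : ℂ} (hP : P.re ≤ 0) (hQ : Q.re ≤ 0) :
    ‖1 - conj (cayley P) * cayley Q‖ = 2 * ‖P + conj Q‖ / (‖P - 1‖ * ‖Q - 1‖) := by
  have h1 : conj P - 1 ≠ 0 := sub_one_ne_zero_of_re_nonpos (by simpa using hP)
  have h2 := sub_one_ne_zero_of_re_nonpos hQ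
  have : 1 - conj (cayley P) * cayley Q
      = -(2 * conj (P + conj Q)) / (conj (P - 1) * (Q - 1)) := by
    unfold cayley; simp only [map_div₀, map_add, map_sub, map_one, Complex.conj_conj]
    field_simp; ring
  rw [this, norm_div, norm_neg, norm_mul, norm_mul, RCLike.norm_conj, RCLike.norm_conj]
  simp

theorem cayley_pick_iff {P Q : ℂ} (hP : P.re ≤ 0) (hQ : Q.re ≤ 0) (s : ℝ) :
    ‖cayley P - cayley Q‖ ≤ s * ‖1 - conj (cayley P) * cayley Q‖ ↔
      ‖P - Q‖ ≤ s * ‖P + conj Q‖ := by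
  have h1 := norm_pos_iff.2 (sub_one_ne_zero_of_re_nonpos hP)
  have h2 := norm_pos_iff.2 (sub_one_ne_zero_of_re_nonpos hQ)
  rw [norm_cayley_sub hP hQ, norm_one_sub_conj_cayley_mul hP hQ, mul_div_assoc',
    div_le_div_iff_of_pos_right (mul_pos h1 h2)]
  constructor <;> intro h <;> linarith

theorem cayley_differentiableAt {u : ℂ} (hu : u ≠ 1) : DifferentiableAt ℂ cayley u := by
  unfold cayley
  exact DifferentiableAt.fun_div (by fun_prop) (by fun_prop) (sub_ne_zero.2 hu)

/-- Schwarz–Pick lemma for maps of the disc into the closed left half-plane. -/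
theorem norm_sub_le_mobiusDist_mul_of_re_nonpos {u : ℂ → ℂ} (hu : DifferentiableOn ℂ u unitDisc)
    (hb : ∀ x ∈ unitDisc, (u x).re ≤ 0) {a b : ℂ} (ha : a ∈ unitDisc) (hbd : b ∈ unitDisc) :
    ‖u a - u b‖ ≤ mobiusDist a b * ‖u a + conj (u b)‖ := by
  rw [← cayley_pick_iff (hb a ha) (hb b hbd)]
  refine norm_sub_le_mobiusDist_mul (f := fun x => cayley (u x)) ?_ ?_ ha hbd
  · intro x hx
    exact (cayley_differentiableAt (ne_one_of_re_nonpos (hb x hx))).comp_differentiableWithinAt x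
      (hu x hx)
  · exact fun x hx => norm_cayley_le_one (hb x hx)

/-- Rigidity at unimodular values: if `‖p‖ = 1` then `‖1 - conj p * q‖ = ‖p - q‖`, so the Pick
inequality with `s < 1` forces `p = q`. -/
theorem eq_of_pick_of_norm_eq_one {p q : ℂ} {s : ℝ} (h1 : s < 1)
    (h : ‖p - q‖ ≤ s * ‖1 - conj p * q‖) (hp : ‖p‖ = 1) : p = q := by
  have e : ‖1 - conj p * q‖ = ‖p - q‖ := by
    have h3 := sq_norm_one_sub_conj_mul_sub p q
    rw [← sq_eq_sq₀ (norm_nonneg _) (norm_nonneg _), ← sub_eq_zero, h3]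
    simp [hp]
  rw [e] at h
  have h4 : ‖p - q‖ = 0 := by nlinarith [norm_nonneg (p - q)]
  rwa [norm_eq_zero, sub_eq_zero] at h4

/-- Converse of the Schwarz–Pick lemma: two-point interpolation by a map into the closed disc. -/
theorem exists_interpolation {p q : ℂ} (hp : ‖p‖ ≤ 1) (hq : ‖q‖ ≤ 1) {s : ℝ} (h0 : 0 < s)
    (h1 : s < 1) (h : ‖p - q‖ ≤ s * ‖1 - conj p * q‖) :
    ∃ f : ℂ → ℂ, DifferentiableOn ℂ f unitDisc ∧ (∀ x ∈ unitDisc, ‖f x‖ ≤ 1) ∧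
      f 0 = p ∧ f s = q := by
  rcases hp.lt_or_eq with hp | hp
  · -- `t` is the factor that takes `s` to the position of `q` as seen from `p`.
    set t : ℂ := discShift (-p) q / s with ht
    have hs : (s : ℂ) ≠ 0 := by exact_mod_cast h0.ne'
    have hne := one_sub_conj_mul_ne_zero hp hq
    have hnd : ‖discShift (-p) q‖ ≤ s := by
      rw [norm_discShift_neg, mobiusDist, div_le_iff₀ (norm_pos_iff.2 hne)]
      exact h
    have ht1 : ‖t‖ ≤ 1 := by
      rw [ht, norm_div, Complex.norm_real, Real.norm_of_nonneg h0.le, div_le_one h0]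
      exact hnd
    have hm : MapsTo (fun x => t * x) unitDisc unitDisc := by
      intro x hx
      rw [mem_unitDisc] at hx ⊢
      rw [norm_mul]
      nlinarith [norm_nonneg t, norm_nonneg x]
    refine ⟨fun x => discShift p (t * x), ?_, ?_, ?_, ?_⟩
    · exact (discShift_differentiableOn hp).comp (by fun_prop) hm
    · exact fun x hx => (mem_unitDisc.1 (discShift_mapsTo hp (hm hx))).le
    · simp [discShift]
    · have e : t * s = discShift (-p) q := by rw [ht]; field_simp
      simp only [e]
      exact discShift_discShift_neg hp hq
  · exact ⟨fun _ => p, by fun_prop, fun _ _ => hp.le, rfl,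
      eq_of_pick_of_norm_eq_one h1 h hp⟩

/-- Two-point interpolation by a map into the closed left half-plane. -/
theorem exists_interpolation_of_re_nonpos {P Q : ℂ} (hP : P.re ≤ 0) (hQ : Q.re ≤ 0) {s : ℝ}
    (h0 : 0 < s) (h1 : s < 1) (h : ‖P - Q‖ ≤ s * ‖P + conj Q‖) :
    ∃ u : ℂ → ℂ, DifferentiableOn ℂ u unitDisc ∧ (∀ x ∈ unitDisc, (u x).re ≤ 0) ∧
      u 0 = P ∧ u s = Q := by
  obtain ⟨f, hf, hfb, hf0, hfs⟩ := exists_interpolation (norm_cayley_le_one hP)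
    (norm_cayley_le_one hQ) h0 h1 ((cayley_pick_iff hP hQ s).2 h)
  have hz : (0 : ℂ) ∈ unitDisc := by simp [mem_unitDisc]
  have hf1 : ∀ x ∈ unitDisc, f x ≠ 1 := by
    intro x hx hx1
    rcases norm_lt_one_or_eq hf hfb with h | h
    · simpa [hx1] using h x hx
    · exact cayley_ne_one P (by rw [← hf0, h 0 hz x hx, hx1])
  refine ⟨fun x => cayley (f x), ?_, fun x hx => cayley_re_nonpos (hfb x hx), ?_, ?_⟩
  · intro x hx
    exact (cayley_differentiableAt (hf1 x hx)).comp_differentiableWithinAt x (hf x hx)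
  · simp only [hf0, cayley_cayley (ne_one_of_re_nonpos hP)]
  · simp only [hfs, cayley_cayley (ne_one_of_re_nonpos hQ)]

/-! ### Inner factors of functions holomorphic on the closed disc -/

theorem norm_discShift_neg_of_mem_sphere {u z : ℂ} (hu : ‖u‖ < 1) (hz : z ∈ sphere (0 : ℂ) 1) :
    ‖discShift (-u) z‖ = 1 := by
  have hz1 : ‖z‖ = 1 := by simpa using hz
  have h0 := one_sub_conj_mul_ne_zero hu hz1.le
  have h := sq_norm_one_sub_conj_mul_sub u z
  rw [norm_discShift_neg, mobiusDist, div_eq_one_iff_eq (norm_ne_zero_iff.2 h0),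
    ← sq_eq_sq₀ (norm_nonneg _) (norm_nonneg _)]
  rw [hz1] at h
  linarith

theorem discShift_neg_analyticOnNhd {u : ℂ} (hu : ‖u‖ < 1) :
    AnalyticOnNhd ℂ (discShift (-u)) (closedBall 0 1) := by
  intro z hz
  have h0 := one_add_conj_mul_ne_zero (p := -u) (by simpa using hu) (mem_closedBall_zero_iff.1 hz)
  unfold discShift
  exact AnalyticAt.fun_div (by fun_prop) (by fun_prop) h0

theorem exists_eq_discShift_pow_mul {f : ℂ → ℂ} (hf : AnalyticOnNhd ℂ f (closedBall 0 1))
    {x₀ : ℂ} (hx₀ : x₀ ∈ unitDisc) (h : f x₀ ≠ 0) {u : ℂ} (hu : u ∈ unitDisc) :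
    ∃ (n : ℕ) (g : ℂ → ℂ), AnalyticOnNhd ℂ g (closedBall 0 1) ∧ g u ≠ 0 ∧
      ∀ z ∈ closedBall (0 : ℂ) 1, f z = discShift (-u) z ^ n * g z := by
  have hu1 := mem_unitDisc.1 hu
  have hsub : unitDisc ⊆ closedBall (0 : ℂ) 1 := ball_subset_closedBall
  have hne : ¬∀ᶠ z in 𝓝 u, f z = 0 := fun h0 =>
    h (hf.eqOn_zero_of_preconnected_of_eventuallyEq_zero
      (convex_closedBall (0 : ℂ) 1).isPreconnected (hsub hu) h0 (hsub hx₀))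
  obtain ⟨n, g₀, hg₀, hg₀u, hfg⟩ := (hf u (hsub hu)).exists_eventuallyEq_pow_smul_nonzero_iff.2 hne
  let g₁ : ℂ → ℂ := Function.update (fun z => f z / (z - u) ^ n) u (g₀ u)
  have hg₁ : AnalyticOnNhd ℂ g₁ (closedBall 0 1) := by
    intro z hz
    by_cases hzu : z = u
    · subst hzu
      refine hg₀.congr ?_
      filter_upwards [hfg] with x hx
      by_cases hxz : x = z
      · simp [g₁, hxz]
      · have : (x - z) ^ n ≠ 0 := pow_ne_zero _ (sub_ne_zero.2 hxz)
        simp only [g₁, Function.update_of_ne hxz, hx, smul_eq_mul]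
        field_simp
    · have han : AnalyticAt ℂ (fun z => f z / (z - u) ^ n) z :=
        (hf z hz).fun_div (by fun_prop) (pow_ne_zero _ (sub_ne_zero.2 hzu))
      refine han.congr ?_
      filter_upwards [isOpen_ne.mem_nhds hzu] with x hx
      simp only [g₁, Function.update_of_ne hx]
  have hfg₁ : ∀ z, f z = (z - u) ^ n * g₁ z := by
    intro z
    by_cases hzu : z = u
    · subst hzu
      simpa [g₁] using hfg.self_of_nhds
    · have : (z - u) ^ n ≠ 0 := pow_ne_zero _ (sub_ne_zero.2 hzu)
      simp only [g₁, Function.update_of_ne hzu]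
      field_simp
  refine ⟨n, fun z => (1 - conj u * z) ^ n * g₁ z, ?_, ?_, ?_⟩
  · exact fun z hz => AnalyticAt.fun_mul (by fun_prop) (hg₁ z hz)
  · refine mul_ne_zero (pow_ne_zero _ (one_sub_conj_mul_ne_zero hu1 hu1.le)) ?_
    simpa [g₁] using hg₀u
  · intro z hz
    have h0 := one_sub_conj_mul_ne_zero hu1 (mem_closedBall_zero_iff.1 hz)
    have e : discShift (-u) z = (z - u) / (1 - conj u * z) := by
      simp [discShift, sub_eq_add_neg]
    rw [e, ← mul_assoc, ← mul_pow, div_mul_cancel₀ _ h0]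
    exact hfg₁ z

/-- A function holomorphic on the closed disc is the product of a finite Blaschke product and a
function without zeros in the open disc. -/
theorem exists_inner_factorization {f : ℂ → ℂ} (hf : AnalyticOnNhd ℂ f (closedBall 0 1))
    {x₀ : ℂ} (hx₀ : x₀ ∈ unitDisc) (h : f x₀ ≠ 0) :
    ∃ B ψ : ℂ → ℂ, AnalyticOnNhd ℂ B (closedBall 0 1) ∧ AnalyticOnNhd ℂ ψ (closedBall 0 1) ∧
      (∀ z ∈ closedBall (0 : ℂ) 1, f z = B z * ψ z) ∧ (∀ z ∈ unitDisc, ψ z ≠ 0) ∧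
      ∀ z ∈ sphere (0 : ℂ) 1, ‖B z‖ = 1 := by
  have hsub : unitDisc ⊆ closedBall (0 : ℂ) 1 := ball_subset_closedBall
  have main : ∀ s : Finset ℂ, ∀ f : ℂ → ℂ, AnalyticOnNhd ℂ f (closedBall 0 1) → f x₀ ≠ 0 →
      (∀ z ∈ unitDisc, f z = 0 → z ∈ s) →
      ∃ B ψ : ℂ → ℂ, AnalyticOnNhd ℂ B (closedBall 0 1) ∧ AnalyticOnNhd ℂ ψ (closedBall 0 1) ∧
        (∀ z ∈ closedBall (0 : ℂ) 1, f z = B z * ψ z) ∧ (∀ z ∈ unitDisc, ψ z ≠ 0) ∧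
        ∀ z ∈ sphere (0 : ℂ) 1, ‖B z‖ = 1 := by
    intro s
    induction s using Finset.induction with
    | empty =>
      intro f hf _ hz
      exact ⟨fun _ => 1, f, analyticOnNhd_const, hf, by simp,
        fun z hzd h0 => by simpa using hz z hzd h0, by simp⟩
    | insert u s _ ih =>
      intro f hf hfx hz
      by_cases hu : u ∈ unitDisc
      · obtain ⟨n, g, hg, hgu, hfg⟩ := exists_eq_discShift_pow_mul hf hx₀ hfx hu
        have hu1 := mem_unitDisc.1 hu
        have hgx : g x₀ ≠ 0 := by
          intro h0
          exact hfx (by rw [hfg x₀ (hsub hx₀), h0, mul_zero])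
        obtain ⟨B, ψ, hB, hψ, hBψ, hψ0, hB1⟩ := ih g hg hgx (by
          intro z hzd h0
          have := hz z hzd (by rw [hfg z (hsub hzd), h0, mul_zero])
          rcases Finset.mem_insert.1 this with rfl | h1
          · exact absurd h0 hgu
          · exact h1)
        refine ⟨fun z => discShift (-u) z ^ n * B z, ψ, ?_, hψ, ?_, hψ0, ?_⟩
        · exact fun z hz => ((discShift_neg_analyticOnNhd hu1 z hz).fun_pow n).fun_mul (hB z hz)
        · intro z hz
          rw [hfg z hz, hBψ z hz, mul_assoc]
        · intro z hz
          rw [norm_mul, norm_pow, norm_discShift_neg_of_mem_sphere hu1 hz, hB1 z hz]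
          simp
      · refine ih f hf hfx fun z hzd h0 => ?_
        rcases Finset.mem_insert.1 (hz z hzd h0) with rfl | h1
        · exact absurd hzd hu
        · exact h1
  have hfin : {z ∈ closedBall (0 : ℂ) 1 | f z = 0}.Finite := by
    rcases hf.eqOn_zero_or_eventually_ne_zero_of_preconnected
      (convex_closedBall (0 : ℂ) 1).isPreconnected with h0 | h0
    · exact absurd (h0 (hsub hx₀)) h
    · refine ((isCompact_closedBall (0 : ℂ) 1).finite_sdiff_of_mem_codiscreteWithin h0).subset ?_
      rintro z ⟨hz, hz0⟩
      exact ⟨hz, fun h1 => h1 hz0⟩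
  exact main hfin.toFinset f hf h fun z hz h0 => by simpa using ⟨by simpa using hsub hz, h0⟩

/-- A zero-free holomorphic function on the disc has a holomorphic logarithm. -/
theorem exists_log_unitDisc {f : ℂ → ℂ} (hf : DifferentiableOn ℂ f unitDisc)
    (h0 : ∀ z ∈ unitDisc, f z ≠ 0) :
    ∃ g : ℂ → ℂ, DifferentiableOn ℂ g unitDisc ∧ ∀ z ∈ unitDisc, exp (g z) = f z := by
  have hz : (0 : ℂ) ∈ unitDisc := by simp [mem_unitDisc]
  have hd : DifferentiableOn ℂ (fun z => deriv f z / f z) (ball 0 1) :=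
    (hf.deriv isOpen_ball).fun_div hf h0
  obtain ⟨g, hg0, hg⟩ := hd.isExactOn_ball.with_val_at 0 (log (f 0))
  have hgd : DifferentiableOn ℂ g unitDisc := fun z hz =>
    (hg z hz).differentiableAt.differentiableWithinAt
  refine ⟨g, hgd, ?_⟩
  have hcon : ∀ z ∈ unitDisc, HasDerivAt (fun z => exp (-g z) * f z) 0 z := by
    intro z hz
    have h1 := ((hg z hz).neg.cexp).mul
      ((hf.differentiableAt (isOpen_ball.mem_nhds hz)).hasDerivAt)
    refine h1.congr_deriv ?_
    have := h0 z hz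
    simp
    field_simp
    ring
  intro z hzd
  have key := (convex_ball (0 : ℂ) 1).is_const_of_fderivWithin_eq_zero (𝕜 := ℂ)
    (f := fun z => exp (-g z) * f z)
    (fun z hz => (hcon z hz).differentiableAt.differentiableWithinAt) (fun x hx => by
      rw [fderivWithin_of_isOpen isOpen_ball hx]
      ext
      simpa using (hcon x hx).deriv) hz hzd
  simp only [hg0, exp_neg, exp_log (h0 0 hz)] at key
  rw [inv_mul_cancel₀ (h0 0 hz)] at key
  field_simp at key
  exact key

/-! ### Interpolation data of an analytic disc -/

/-- Two-point data recording what remains of an analytic disc `φ` in an elementary Reinhardt domain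
after factoring `φ j = B j * exp (g j)` with `B j` inner: the values `b j`, `c j` of `B j`
and the values `P`, `Q` of `u = ∑ j, α j * g j` at two points of Möbius distance `s`. The
inequalities are the Schwarz–Pick conditions for maps into the disc and into the left half-plane,
and `x`, `y` are the values of `φ ^ α`. -/
structure PickData (α : Fin n → ℕ) (x y : ℂ) (s : ℝ) (b c : Fin n → ℂ) (P Q : ℂ) : Prop where
  norm_left_le : ∀ j, ‖b j‖ ≤ 1
  norm_right_le : ∀ j, ‖c j‖ ≤ 1
  pick_disc : ∀ j, ‖b j - c j‖ ≤ s * ‖1 - conj (b j) * c j‖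
  re_left_nonpos : P.re ≤ 0
  re_right_nonpos : Q.re ≤ 0
  pick_halfPlane : ‖P - Q‖ ≤ s * ‖P + conj Q‖
  exp_left : exp P * monomial α b = x
  exp_right : exp Q * monomial α c = y

theorem norm_monomial (α : Fin n → ℕ) (z : Fin n → ℂ) :
    ‖monomial α z‖ = ∏ j, ‖z j‖ ^ α j := by
  simp [monomial, norm_prod]

theorem monomial_mul (α : Fin n → ℕ) (z w : Fin n → ℂ) :
    monomial α (fun j => z j * w j) = monomial α z * monomial α w := by
  simp [monomial, mul_pow, Finset.prod_mul_distrib]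

theorem monomial_exp (α : Fin n → ℕ) (g : Fin n → ℂ) :
    monomial α (fun j => exp (g j)) = exp (∑ j, α j * g j) := by
  simp [monomial, exp_sum, exp_nat_mul]

theorem norm_monomial_le_one {α : Fin n → ℕ} {z : Fin n → ℂ} (h : ∀ j, ‖z j‖ ≤ 1) :
    ‖monomial α z‖ ≤ 1 := by
  rw [norm_monomial]
  exact Finset.prod_le_one (fun j _ => by positivity)
    fun j _ => pow_le_one₀ (norm_nonneg _) (h j)

theorem ne_zero_of_monomial_ne_zero {α : Fin n → ℕ} (hpos : ∀ j, 0 < α j) {z : Fin n → ℂ}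
    (h : monomial α z ≠ 0) (j : Fin n) : z j ≠ 0 := by
  intro h0
  exact h (Finset.prod_eq_zero (Finset.mem_univ j) (by simp [h0, (hpos j).ne']))

theorem analyticOnNhd_monomial {α : Fin n → ℕ} {f : Fin n → ℂ → ℂ} {S : Set ℂ}
    (hf : ∀ j, AnalyticOnNhd ℂ (f j) S) : AnalyticOnNhd ℂ (fun z => monomial α (f · z)) S := by
  intro z hz
  unfold monomial
  exact Finset.analyticAt_fun_prod _ fun j _ => (hf j z hz).fun_pow _

theorem norm_le_one_of_sphere {f : ℂ → ℂ} (hf : AnalyticOnNhd ℂ f (closedBall 0 1))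
    (hb : ∀ z ∈ sphere (0 : ℂ) 1, ‖f z‖ ≤ 1) : ∀ z ∈ unitDisc, ‖f z‖ ≤ 1 := by
  intro z hz
  refine Complex.norm_le_of_forall_mem_frontier_norm_le (U := ball 0 1) isBounded_ball
    (hf.differentiableOn.mono closure_ball_subset_closedBall).diffContOnCl ?_ (subset_closure hz)
  exact fun w hw => hb w (frontier_ball_subset_sphere hw)

/-- Restricting an analytic disc to the smaller disc of radius `ρ` makes it holomorphic up to
the boundary, and the inner factors of its coordinates then yield interpolation data. -/
theorem exists_pickData_of_isAnalyticDisc {α : Fin n → ℕ} {φ : ℂ → Fin n → ℂ}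
    (hφ : IsAnalyticDisc (reinhardtDomain α) φ) {a b : ℂ} {ρ : ℝ} (hρ : ρ < 1)
    (ha : ‖a‖ < ρ) (hb : ‖b‖ < ρ) (h0 : ∀ j, φ a j ≠ 0) :
    ∃ B C P Q, PickData α (monomial α (φ a)) (monomial α (φ b))
      (mobiusDist (a / ρ) (b / ρ)) B C P Q := by
  have hρ0 : 0 < ρ := (norm_nonneg a).trans_lt ha
  have hρc : (ρ : ℂ) ≠ 0 := by exact_mod_cast hρ0.ne'
  have hsub : unitDisc ⊆ closedBall (0 : ℂ) 1 := ball_subset_closedBall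
  have hdiv : ∀ {x : ℂ}, ‖x‖ < ρ → x / ρ ∈ unitDisc := by
    intro x hx
    rw [mem_unitDisc, norm_div, Complex.norm_real, Real.norm_of_nonneg hρ0.le, div_lt_one hρ0]
    exact hx
  have hmul : MapsTo (fun x : ℂ => ρ * x) (closedBall 0 1) unitDisc := by
    intro x hx
    rw [mem_closedBall_zero_iff] at hx
    rw [mem_unitDisc, norm_mul, Complex.norm_real, Real.norm_of_nonneg hρ0.le]
    nlinarith [norm_nonneg x]
  have hcancel : ∀ x : ℂ, ρ * (x / ρ) = x := fun x => mul_div_cancel₀ x hρc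
  let f : Fin n → ℂ → ℂ := fun j x => φ (ρ * x) j
  have hf : ∀ j, AnalyticOnNhd ℂ (f j) (closedBall 0 1) := by
    intro j
    have h1 : DifferentiableOn ℂ (fun x => φ x j) unitDisc := differentiableOn_pi.1 hφ.1 j
    have h2 : AnalyticOnNhd ℂ (fun x => φ x j) unitDisc := h1.analyticOnNhd isOpen_ball
    exact h2.comp (g := fun x : ℂ => φ x j) (fun x _ => by fun_prop) hmul
  have hfa : ∀ j, f j (a / ρ) ≠ 0 := by
    intro j
    simp only [f, hcancel]
    exact h0 j
  choose B ψ hB hψ hBψ hψ0 hB1 using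
    fun j => exists_inner_factorization (hf j) (hdiv ha) (hfa j)
  choose g hg hgψ using
    fun j => exists_log_unitDisc ((hψ j).differentiableOn.mono hsub) (hψ0 j)
  have hBle : ∀ j, ∀ z ∈ unitDisc, ‖B j z‖ ≤ 1 := fun j =>
    norm_le_one_of_sphere (hB j) fun z hz => (hB1 j z hz).le
  let u : ℂ → ℂ := fun z => ∑ j, α j * g j z
  have hu : DifferentiableOn ℂ u unitDisc :=
    DifferentiableOn.fun_sum fun j _ => (hg j).const_mul _
  have hexp : ∀ z ∈ unitDisc, exp (u z) = monomial α (ψ · z) := by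
    intro z hz
    rw [← monomial_exp]
    congr 1
    ext j
    exact hgψ j z hz
  -- On the unit circle the inner factors are unimodular, so there `|ψ ^ α| = |φ ^ α| ≤ 1`.
  have hψle : ∀ z ∈ unitDisc, ‖monomial α (ψ · z)‖ ≤ 1 := by
    refine norm_le_one_of_sphere (analyticOnNhd_monomial hψ) fun z hz => ?_
    have hzc := sphere_subset_closedBall hz
    have h1 : ∏ j, ‖φ (ρ * z) j‖ ^ α j < 1 := hφ.2 (hmul hzc)
    rw [norm_monomial]
    refine le_trans (le_of_eq ?_) h1.le
    refine Finset.prod_congr rfl fun j _ => ?_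
    have h2 : φ (ρ * z) j = B j z * ψ j z := hBψ j z hzc
    rw [h2, norm_mul, hB1 j z hz, one_mul]
  have hure : ∀ z ∈ unitDisc, (u z).re ≤ 0 := by
    intro z hz
    have h1 := hψle z hz
    rwa [← hexp z hz, norm_exp, Real.exp_le_one_iff] at h1
  have hval : ∀ {x : ℂ}, ‖x‖ < ρ →
      exp (u (x / ρ)) * monomial α (B · (x / ρ)) = monomial α (φ x) := by
    intro x hx
    rw [hexp _ (hdiv hx), mul_comm, ← monomial_mul]
    congr 1
    ext j
    have h2 := hBψ j (x / ρ) (hsub (hdiv hx))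
    simp only [f, hcancel] at h2
    exact h2.symm
  exact ⟨(B · (a / ρ)), (B · (b / ρ)), u (a / ρ), u (b / ρ),
    { norm_left_le := fun j => hBle j _ (hdiv ha)
      norm_right_le := fun j => hBle j _ (hdiv hb)
      pick_disc := fun j => norm_sub_le_mobiusDist_mul ((hB j).differentiableOn.mono hsub)
        (hBle j) (hdiv ha) (hdiv hb)
      re_left_nonpos := hure _ (hdiv ha)
      re_right_nonpos := hure _ (hdiv hb)
      pick_halfPlane := norm_sub_le_mobiusDist_mul_of_re_nonpos hu hure (hdiv ha) (hdiv hb)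
      exp_left := hval ha
      exp_right := hval hb }⟩

/-- `mobiusDist` is a lower bound as soon as all `mobiusDist (a / ρ) (b / ρ)`, `ρ < 1`, are. -/
theorem le_mobiusDist_of_forall_div {a b : ℂ} (ha : ‖a‖ < 1) (hb : ‖b‖ < 1) {s : ℝ}
    (h : ∀ ρ : ℝ, ρ < 1 → ‖a‖ < ρ → ‖b‖ < ρ → s ≤ mobiusDist (a / ρ) (b / ρ)) :
    s ≤ mobiusDist a b := by
  have hlim : Tendsto (fun ρ : ℝ => mobiusDist (a / ρ) (b / ρ)) (𝓝[<] 1)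
      (𝓝 (mobiusDist a b)) := by
    have hc : ContinuousAt (fun ρ : ℝ => mobiusDist (a / ρ) (b / ρ)) 1 := by
      have h1 : ContinuousAt (fun ρ : ℝ => a / (ρ : ℂ)) 1 :=
        continuousAt_const.div Complex.continuous_ofReal.continuousAt (by simp)
      have h2 : ContinuousAt (fun ρ : ℝ => b / (ρ : ℂ)) 1 :=
        continuousAt_const.div Complex.continuous_ofReal.continuousAt (by simp)
      unfold mobiusDist
      refine (h1.sub h2).norm.div
        (continuousAt_const.sub ((Complex.continuous_conj.continuousAt.comp h1).mul h2)).norm ?_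
      simpa using one_sub_conj_mul_ne_zero ha hb.le
    have := hc.tendsto.mono_left (nhdsWithin_le_nhds (s := Iio 1))
    simpa using this
  refine ge_of_tendsto hlim ?_
  filter_upwards [self_mem_nhdsWithin, nhdsWithin_le_nhds (Ioi_mem_nhds ha),
    nhdsWithin_le_nhds (Ioi_mem_nhds hb)] with ρ h1 h2 h3
  exact h ρ h1 h2 h3

/-! ### A minimal Möbius distance among interpolation data -/

theorem norm_sub_lt_norm_add_conj {P Q : ℂ} (hP : P.re < 0) (hQ : Q.re < 0) :
    ‖P - Q‖ < ‖P + conj Q‖ := by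
  refine lt_of_pow_lt_pow_left₀ 2 (norm_nonneg _) ?_
  rw [← Complex.normSq_eq_norm_sq, ← Complex.normSq_eq_norm_sq, Complex.normSq_apply,
    Complex.normSq_apply]
  simp
  nlinarith [mul_pos_of_neg_of_neg hP hQ]

theorem PickData.norm_right_halfPlane_le {α : Fin n → ℕ} {x y : ℂ} {s s₀ : ℝ} {b c : Fin n → ℂ}
    {P Q : ℂ} (h : PickData α x y s b c P Q) (h0 : 0 ≤ s₀) (hs : s ≤ s₀)
    (hs₀ : s₀ < 1) : ‖Q‖ ≤ (1 + s₀) / (1 - s₀) * ‖P‖ := by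
  have h1 := h.pick_halfPlane
  have h2 : ‖P + conj Q‖ ≤ ‖P‖ + ‖Q‖ := by
    simpa using norm_add_le P (conj Q)
  have h3 : ‖Q‖ - ‖P‖ ≤ ‖P - Q‖ := by
    rw [norm_sub_rev]; exact norm_sub_norm_le Q P
  have h4 : s * ‖P + conj Q‖ ≤ s₀ * ‖P + conj Q‖ :=
    mul_le_mul_of_nonneg_right hs (norm_nonneg _)
  rw [div_mul_eq_mul_div, le_div_iff₀ (by linarith)]
  nlinarith [mul_le_mul_of_nonneg_left h2 h0]

theorem PickData.log_norm_le_re {α : Fin n → ℕ} {x y : ℂ} {s : ℝ} {b c : Fin n → ℂ}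
    {P Q : ℂ} (h : PickData α x y s b c P Q) (hx : x ≠ 0) : Real.log ‖x‖ ≤ P.re := by
  rw [Real.log_le_iff_le_exp (norm_pos_iff.2 hx), ← h.exp_left, norm_mul, norm_exp]
  exact mul_le_of_le_one_right (Real.exp_pos _).le (norm_monomial_le_one h.norm_left_le)

theorem PickData.add_two_pi_I {α : Fin n → ℕ} {x y : ℂ} {s : ℝ} {b c : Fin n → ℂ}
    {P Q : ℂ} (h : PickData α x y s b c P Q) (k : ℤ) :
    PickData α x y s b c (P + k * (2 * Real.pi * I)) (Q + k * (2 * Real.pi * I)) where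
  norm_left_le := h.norm_left_le
  norm_right_le := h.norm_right_le
  pick_disc := h.pick_disc
  re_left_nonpos := by simpa using h.re_left_nonpos
  re_right_nonpos := by simpa using h.re_right_nonpos
  pick_halfPlane := by
    convert! h.pick_halfPlane using 2
    · ring_nf
    · have e : conj (k * (2 * Real.pi * I)) = -(k * (2 * Real.pi * I)) := by
        simp [Complex.ext_iff]
      rw [map_add, e]
      ring_nf
  exp_left := by rw [exp_add, exp_int_mul_two_pi_mul_I, mul_one]; exact h.exp_left
  exp_right := by rw [exp_add, exp_int_mul_two_pi_mul_I, mul_one]; exact h.exp_right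

theorem PickData.pos {α : Fin n → ℕ} {x y : ℂ} {s : ℝ} {b c : Fin n → ℂ}
    {P Q : ℂ} (h : PickData α x y s b c P Q) (hxy : x ≠ y) : 0 < s := by
  by_contra hs
  have hs := not_lt.1 hs
  apply hxy
  have h1 : ∀ j, b j = c j := by
    intro j
    rw [← sub_eq_zero, ← norm_le_zero_iff]
    exact (h.pick_disc j).trans (mul_nonpos_of_nonpos_of_nonneg hs (norm_nonneg _))
  have h2 : P = Q := by
    rw [← sub_eq_zero, ← norm_le_zero_iff]
    exact h.pick_halfPlane.trans (mul_nonpos_of_nonpos_of_nonneg hs (norm_nonneg _))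
  rw [← h.exp_left, ← h.exp_right, h2, funext h1]

theorem isClosed_setOf_pickData (α : Fin n → ℕ) (x y : ℂ) :
    IsClosed {t : ℝ × (Fin n → ℂ) × (Fin n → ℂ) × ℂ × ℂ |
      PickData α x y t.1 t.2.1 t.2.2.1 t.2.2.2.1 t.2.2.2.2} := by
  have hc : Continuous fun z : ℂ => conj z := Complex.continuous_conj
  have hm : Continuous (monomial α) := by unfold monomial; fun_prop
  have e : {t : ℝ × (Fin n → ℂ) × (Fin n → ℂ) × ℂ × ℂ |
      PickData α x y t.1 t.2.1 t.2.2.1 t.2.2.2.1 t.2.2.2.2} =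
      {t | (∀ j, ‖t.2.1 j‖ ≤ 1) ∧ (∀ j, ‖t.2.2.1 j‖ ≤ 1) ∧
        (∀ j, ‖t.2.1 j - t.2.2.1 j‖ ≤ t.1 * ‖1 - conj (t.2.1 j) * t.2.2.1 j‖) ∧
        t.2.2.2.1.re ≤ 0 ∧ t.2.2.2.2.re ≤ 0 ∧
        ‖t.2.2.2.1 - t.2.2.2.2‖ ≤ t.1 * ‖t.2.2.2.1 + conj t.2.2.2.2‖ ∧
        exp t.2.2.2.1 * monomial α t.2.1 = x ∧ exp t.2.2.2.2 * monomial α t.2.2.1 = y} := by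
    ext t
    exact ⟨fun ⟨h1, h2, h3, h4, h5, h6, h7, h8⟩ => ⟨h1, h2, h3, h4, h5, h6, h7, h8⟩,
      fun ⟨h1, h2, h3, h4, h5, h6, h7, h8⟩ => ⟨h1, h2, h3, h4, h5, h6, h7, h8⟩⟩
  rw [e]
  simp only [ofPred_and, ofPred_forall]
  refine (isClosed_iInter fun j => isClosed_le ?_ ?_).inter
    ((isClosed_iInter fun j => isClosed_le ?_ ?_).inter
    ((isClosed_iInter fun j => isClosed_le ?_ ?_).inter
    ((isClosed_le ?_ ?_).inter ((isClosed_le ?_ ?_).inter ((isClosed_le ?_ ?_).inter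
    ((isClosed_eq ?_ ?_).inter (isClosed_eq ?_ ?_))))))) <;> fun_prop

/-- Among all interpolation data with given values of the monomial there is one with smallest `s`:
after a common shift of `P` and `Q` by a multiple of `2πi`, the data with `s` bounded away from `1`
form a compact set. -/
theorem exists_minimal_pickData (α : Fin n → ℕ) {x y : ℂ} (hx : x ≠ 0) (hy : y ≠ 0)
    (hx1 : ‖x‖ < 1) (hy1 : ‖y‖ < 1) (hxy : x ≠ y) :
    ∃ s b c P Q, PickData α x y s b c P Q ∧ 0 < s ∧ s < 1 ∧
      ∀ s' b' c' P' Q', PickData α x y s' b' c' P' Q' → s ≤ s' := by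
  have hre : ∀ {x : ℂ}, x ≠ 0 → ‖x‖ < 1 → (log x).re < 0 := fun hx hx1 => by
    rw [log_re]; exact Real.log_neg (norm_pos_iff.2 hx) hx1
  have hlt := norm_sub_lt_norm_add_conj (hre hx hx1) (hre hy hy1)
  have hden : 0 < ‖log x + conj (log y)‖ := (norm_nonneg _).trans_lt hlt
  set s₀ : ℝ := ‖log x - log y‖ / ‖log x + conj (log y)‖ with hs₀
  have hs₀1 : s₀ < 1 := (div_lt_one hden).2 hlt
  have hs₀0 : 0 ≤ s₀ := by positivity
  have hinit : PickData α x y s₀ (fun _ => 1) (fun _ => 1) (log x) (log y) :=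
    { norm_left_le := by simp
      norm_right_le := by simp
      pick_disc := by simp
      re_left_nonpos := (hre hx hx1).le
      re_right_nonpos := (hre hy hy1).le
      pick_halfPlane := by rw [hs₀, div_mul_cancel₀ _ hden.ne']
      exp_left := by simp [monomial, exp_log hx]
      exp_right := by simp [monomial, exp_log hy] }
  let K : Set (ℝ × (Fin n → ℂ) × (Fin n → ℂ) × ℂ × ℂ) :=
    {t | PickData α x y t.1 t.2.1 t.2.2.1 t.2.2.2.1 t.2.2.2.2} ∩
      {t | 0 ≤ t.1 ∧ t.1 ≤ s₀ ∧ -Real.pi ≤ t.2.2.2.1.im ∧ t.2.2.2.1.im ≤ Real.pi}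
  have hclosed : IsClosed K := by
    refine (isClosed_setOf_pickData α x y).inter ?_
    simp only [ofPred_and]
    refine (isClosed_le ?_ ?_).inter ((isClosed_le ?_ ?_).inter ((isClosed_le ?_ ?_).inter
      (isClosed_le ?_ ?_))) <;> fun_prop
  set R : ℝ := -Real.log ‖x‖ + Real.pi with hR
  have hbdd : Bornology.IsBounded K := by
    refine ((isBounded_Icc (0 : ℝ) s₀).prod ((isBounded_closedBall (x := 0) (r := 1)).prod
      ((isBounded_closedBall (x := 0) (r := 1)).prod
      ((isBounded_closedBall (x := 0) (r := R)).prod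
      (isBounded_closedBall (x := 0) (r := (1 + s₀) / (1 - s₀) * R)))))).subset ?_
    rintro ⟨s, b, c, P, Q⟩ ⟨h, h1, h2, h3, h4⟩
    simp only at h h1 h2 h3 h4
    have hP : ‖P‖ ≤ R := by
      refine (Complex.norm_le_abs_re_add_abs_im P).trans (add_le_add ?_ (abs_le.2 ⟨h3, h4⟩))
      rw [abs_of_nonpos h.re_left_nonpos]
      exact neg_le_neg (h.log_norm_le_re hx)
    refine ⟨⟨h1, h2⟩, ?_, ?_, by simpa using hP, ?_⟩
    · simpa [pi_norm_le_iff_of_nonneg] using h.norm_left_le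
    · simpa [pi_norm_le_iff_of_nonneg] using h.norm_right_le
    · rw [mem_closedBall_zero_iff]
      refine (h.norm_right_halfPlane_le hs₀0 h2 hs₀1).trans (mul_le_mul_of_nonneg_left hP ?_)
      exact div_nonneg (by linarith) (by linarith)
  have hKc : IsCompact K := Metric.isCompact_of_isClosed_isBounded hclosed hbdd
  have hKne : K.Nonempty := by
    refine ⟨(s₀, (fun _ => 1), (fun _ => 1), log x, log y), hinit, hs₀0, le_rfl, ?_, ?_⟩
    · simpa [log_im] using (neg_pi_lt_arg x).le
    · simpa [log_im] using arg_le_pi x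
  obtain ⟨⟨s, b, c, P, Q⟩, ⟨h, h1, h2, -⟩, hmin⟩ :=
    hKc.exists_isMinOn hKne continuous_fst.continuousOn
  refine ⟨s, b, c, P, Q, h, h.pos hxy, lt_of_le_of_lt h2 hs₀1, ?_⟩
  intro s' b' c' P' Q' h'
  rcases le_or_gt s₀ s' with hs | hs
  · exact le_trans h2 hs
  · obtain ⟨k, hk, -⟩ := existsUnique_add_zsmul_mem_Ioc Real.two_pi_pos P'.im (-Real.pi)
    have hk' : P'.im + k * (2 * Real.pi) ∈ Ioc (-Real.pi) (-Real.pi + 2 * Real.pi) := by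
      simpa using hk
    have him : (P' + k * (2 * Real.pi * I)).im = P'.im + k * (2 * Real.pi) := by simp
    exact hmin (a := (s', b', c', P' + k * (2 * Real.pi * I), Q' + k * (2 * Real.pi * I)))
      ⟨h'.add_two_pi_I k, (h'.pos hxy).le, hs.le, by rw [him]; exact hk'.1.le,
        by rw [him]; linarith [hk'.2]⟩

/-! ### Reconstruction of a bounded disc from interpolation data -/

theorem exists_int_sum_mul_eq_one {α : Fin n → ℕ} (hcop : Finset.univ.gcd α = 1) :
    ∃ k : Fin n → ℤ, ∑ j, (α j : ℤ) * k j = 1 := by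
  obtain ⟨g, hg⟩ := Finset.gcd_eq_sum_mul Finset.univ (fun j => (α j : ℤ))
  set d : ℤ := Finset.univ.gcd (fun j => (α j : ℤ)) with hd
  have h1 : d.natAbs ∣ 1 := by
    rw [← hcop]
    refine Finset.dvd_gcd fun j hj => ?_
    have : d ∣ (α j : ℤ) := Finset.gcd_dvd hj
    simpa using Int.natAbs_dvd_natAbs.2 this
  have h2 : d * d = 1 := by
    rw [← Int.natAbs_mul_self, Nat.dvd_one.1 h1]; rfl
  refine ⟨fun j => g j * d, ?_⟩
  calc ∑ j, (α j : ℤ) * (g j * d) = (∑ j, (α j : ℤ) * g j) * d := by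
        rw [Finset.sum_mul]
        exact Finset.sum_congr rfl fun j _ => by ring
    _ = 1 := by rw [← hg, h2]

/-- Logarithms of the quotients `w j / b j` can be chosen with any prescribed admissible weighted
sum; this is where coprimality of the exponents enters. -/
theorem exists_logs {α : Fin n → ℕ} (hcop : Finset.univ.gcd α = 1) {w b : Fin n → ℂ} {P : ℂ}
    (hw : ∀ j, w j ≠ 0) (hb : ∀ j, b j ≠ 0) (h : exp P * monomial α b = monomial α w) :
    ∃ G : Fin n → ℂ, (∀ j, b j * exp (G j) = w j) ∧ ∑ j, α j * G j = P := by
  obtain ⟨k, hk⟩ := exists_int_sum_mul_eq_one hcop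
  let L : Fin n → ℂ := fun j => log (w j / b j)
  have hL : ∀ j, b j * exp (L j) = w j := by
    intro j
    rw [exp_log (div_ne_zero (hw j) (hb j)), mul_div_cancel₀ _ (hb j)]
  have hbm : monomial α b ≠ 0 := Finset.prod_ne_zero_iff.2 fun j _ => pow_ne_zero _ (hb j)
  have he : exp P = exp (∑ j, α j * L j) := by
    refine mul_right_cancel₀ hbm ?_
    rw [h, ← monomial_exp, mul_comm, ← monomial_mul]
    congr 1
    ext j
    exact (hL j).symm
  obtain ⟨N, hN⟩ := exp_eq_exp_iff_exists_int.1 he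
  refine ⟨fun j => L j + (N * k j : ℤ) * (2 * Real.pi * I), fun j => ?_, ?_⟩
  · rw [exp_add, exp_int_mul_two_pi_mul_I, mul_one]
    exact hL j
  · have hk' : ∑ j, (α j : ℂ) * k j = 1 := by exact_mod_cast hk
    rw [hN]
    simp only [mul_add, Finset.sum_add_distrib]
    congr 1
    rw [← mul_one (N : ℂ), ← hk', Finset.mul_sum, Finset.sum_mul]
    refine Finset.sum_congr rfl fun j _ => ?_
    push_cast
    ring

/-- Interpolation data come from a bounded analytic disc, obtained by interpolating each factor.
The weighted sum of the logarithms is prescribed by adding the same multiple of the half-plane map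
`u` to suitable affine functions. -/
theorem PickData.exists_bounded_disc {α : Fin n → ℕ} (hpos : ∀ j, 0 < α j)
    (hcop : Finset.univ.gcd α = 1) {w z : Fin n → ℂ} (hw : monomial α w ≠ 0)
    (hz : monomial α z ≠ 0) (hwz : monomial α w ≠ monomial α z) {s : ℝ} (h0 : 0 < s) (h1 : s < 1)
    {b c : Fin n → ℂ} {P Q : ℂ} (h : PickData α (monomial α w) (monomial α z) s b c P Q) :
    ∃ φ : ℂ → Fin n → ℂ, IsAnalyticDisc (reinhardtDomain α) φ ∧ φ 0 = w ∧ φ s = z ∧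
      Bornology.IsBounded (φ '' unitDisc) := by
  have hs : (s : ℂ) ≠ 0 := by exact_mod_cast h0.ne'
  have hb0 : ∀ j, b j ≠ 0 := ne_zero_of_monomial_ne_zero hpos fun h2 => hw (by
    rw [← h.exp_left, h2, mul_zero])
  have hc0 : ∀ j, c j ≠ 0 := ne_zero_of_monomial_ne_zero hpos fun h2 => hz (by
    rw [← h.exp_right, h2, mul_zero])
  choose B hB hB1 hBb hBc using fun j =>
    exists_interpolation (h.norm_left_le j) (h.norm_right_le j) h0 h1 (h.pick_disc j)
  obtain ⟨u, hu, hure, huP, huQ⟩ :=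
    exists_interpolation_of_re_nonpos h.re_left_nonpos h.re_right_nonpos h0 h1 h.pick_halfPlane
  obtain ⟨G, hG, hGP⟩ :=
    exists_logs hcop (ne_zero_of_monomial_ne_zero hpos hw) hb0 h.exp_left
  obtain ⟨H, hH, hHQ⟩ :=
    exists_logs hcop (ne_zero_of_monomial_ne_zero hpos hz) hc0 h.exp_right
  have hA : ((∑ j, α j : ℕ) : ℂ) ≠ 0 := by
    intro hA
    have hA' : ∑ j, α j = 0 := by exact_mod_cast hA
    have : ∀ j ∈ Finset.univ, α j = 0 := by simpa using hA'
    rw [Finset.gcd_eq_zero_iff.2 this] at hcop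
    exact zero_ne_one hcop
  set A : ℂ := ((∑ j, α j : ℕ) : ℂ) with hAdef
  have hAsum : A = ∑ j, (α j : ℂ) := by rw [hAdef]; push_cast; rfl
  -- The affine functions `L + M x` have zero weighted sum and carry the rest of the logarithms.
  let L : Fin n → ℂ := fun j => G j - P / A
  let M : Fin n → ℂ := fun j => ((H j - Q / A) - (G j - P / A)) / s
  have hL : ∑ j, α j * L j = 0 := by
    simp only [L, mul_sub, Finset.sum_sub_distrib, hGP, ← Finset.sum_mul, ← hAsum]
    field_simp
    ring
  have hL' : ∑ j, α j * (H j - Q / A) = 0 := by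
    simp only [mul_sub, Finset.sum_sub_distrib, hHQ, ← Finset.sum_mul, ← hAsum]
    field_simp
    ring
  have hM : ∑ j, α j * M j = 0 := by
    have : ∑ j, α j * M j = (∑ j, α j * (H j - Q / A) - ∑ j, α j * L j) / s := by
      rw [← Finset.sum_sub_distrib, Finset.sum_div]
      exact Finset.sum_congr rfl fun j _ => by simp only [M, L]; ring
    rw [this, hL, hL']
    simp
  let E : Fin n → ℂ → ℂ := fun j x => L j + M j * x + u x / A
  have hE : ∀ x, ∑ j, α j * E j x = u x := by
    intro x
    have : ∑ j, α j * E j x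
        = ∑ j, α j * L j + (∑ j, α j * M j) * x + (∑ j, (α j : ℂ)) * (u x / A) := by
      rw [Finset.sum_mul, Finset.sum_mul, ← Finset.sum_add_distrib, ← Finset.sum_add_distrib]
      exact Finset.sum_congr rfl fun j _ => by simp only [E]; ring
    rw [this, hL, hM, ← hAsum]
    field_simp
    ring
  let φ : ℂ → Fin n → ℂ := fun x j => B j x * exp (E j x)
  have hφd : DifferentiableOn ℂ φ unitDisc := by
    refine differentiableOn_pi.2 fun j => (hB j).fun_mul (DifferentiableOn.cexp ?_)
    exact DifferentiableOn.fun_add (by fun_prop) (hu.div_const A)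
  have hφm : ∀ x, monomial α (φ x) = monomial α (B · x) * exp (u x) := by
    intro x
    rw [← hE x, ← monomial_exp, ← monomial_mul]
  have hφ0 : φ 0 = w := by
    ext j
    simp only [φ, E, L, hBb, huP, mul_zero, add_zero, sub_add_cancel]
    exact hG j
  have hφs : φ s = z := by
    ext j
    have : E j s = H j := by
      simp only [E, L, M, huQ]
      field_simp
      ring
    simp only [φ, hBc, this]
    exact hH j
  have hmd : DifferentiableOn ℂ (fun x => monomial α (φ x)) unitDisc := by
    unfold monomial
    exact DifferentiableOn.fun_finsetProd fun j _ => (differentiableOn_pi.1 hφd j).fun_pow _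
  have hmle : ∀ x ∈ unitDisc, ‖monomial α (φ x)‖ ≤ 1 := by
    intro x hx
    rw [hφm, norm_mul, norm_exp]
    exact mul_le_one₀ (norm_monomial_le_one fun j => hB1 j x hx) (Real.exp_pos _).le
      (Real.exp_le_one_iff.2 (hure x hx))
  have h0d : (0 : ℂ) ∈ unitDisc := by simp [mem_unitDisc]
  have hsd : (s : ℂ) ∈ unitDisc := by simp [mem_unitDisc, abs_of_pos h0, h1]
  refine ⟨φ, ⟨hφd, fun x hx => ?_⟩, hφ0, hφs, ?_⟩
  · rcases norm_lt_one_or_eq hmd hmle with hlt | heq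
    · have := hlt x hx
      rwa [norm_monomial] at this
    · exact absurd (heq 0 h0d s hsd) (by simpa only [hφ0, hφs] using hwz)
  · refine (isBounded_iff_forall_norm_le).2 ⟨∑ j, Real.exp (‖L j‖ + ‖M j‖), ?_⟩
    rintro _ ⟨x, hx, rfl⟩
    have hsum : 0 ≤ ∑ j, Real.exp (‖L j‖ + ‖M j‖) :=
      Finset.sum_nonneg fun j _ => (Real.exp_pos _).le
    rw [pi_norm_le_iff_of_nonneg hsum]
    intro j
    refine le_trans ?_ (Finset.single_le_sum (f := fun j => Real.exp (‖L j‖ + ‖M j‖))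
      (fun j _ => (Real.exp_pos _).le) (Finset.mem_univ j))
    simp only [φ, norm_mul, norm_exp]
    refine (mul_le_of_le_one_left (Real.exp_pos _).le (hB1 j x hx)).trans
      (Real.exp_le_exp.2 ?_)
    have h3 : (u x / A).re ≤ 0 := by
      rw [hAdef, div_natCast_re]
      exact div_nonpos_of_nonpos_of_nonneg (hure x hx) (Nat.cast_nonneg _)
    have h4 : (L j).re ≤ ‖L j‖ := re_le_norm _
    have h5 : (M j * x).re ≤ ‖M j‖ := by
      refine (re_le_norm _).trans ?_
      rw [norm_mul]
      exact mul_le_of_le_one_right (norm_nonneg _) (mem_unitDisc.1 hx).le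
    simp only [E, add_re]
    linarith

/-! ### Failure of tautness -/

/-- The discs `x ↦ (k x, 0, …, 0)` pass through the origin but are unbounded at `1 / 2`. -/
theorem not_isTaut_reinhardtDomain (hn : 2 ≤ n) {α : Fin n → ℕ} (hpos : ∀ j, 0 < α j) :
    ¬ IsTaut (reinhardtDomain α) := by
  intro hT
  let i₀ : Fin n := ⟨0, by omega⟩
  let i₁ : Fin n := ⟨1, by omega⟩
  have hne : i₁ ≠ i₀ := by simp [i₀, i₁]
  have hD : ∀ z : Fin n → ℂ, z i₁ = 0 → z ∈ reinhardtDomain α := by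
    intro z hz
    have : ∏ j, ‖z j‖ ^ α j = 0 :=
      Finset.prod_eq_zero (Finset.mem_univ i₁) (by simp [hz, (hpos i₁).ne'])
    simp [reinhardtDomain, this]
  have h0d : (0 : ℂ) ∈ unitDisc := by simp [mem_unitDisc]
  have hhd : (1 / 2 : ℂ) ∈ unitDisc := by rw [mem_unitDisc]; norm_num
  obtain ⟨σ, hσ, ⟨ψ, -, hψ⟩ | hcd⟩ := hT (fun k x => Pi.single i₀ (k * x)) (fun k =>
    ⟨differentiableOn_pi.2 fun j => by
      by_cases hj : j = i₀
      · subst hj; simp only [Pi.single_eq_same]; fun_prop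
      · simp only [Pi.single_eq_of_ne hj]; fun_prop,
    fun x _ => hD _ (Pi.single_eq_of_ne hne _)⟩)
  · have h1 := hψ.tendsto_at hhd
    have h2 := ((continuous_apply i₀).tendsto _).comp h1
    have h3 := h2.norm
    refine not_tendsto_nhds_of_tendsto_atTop ?_ _ h3
    have h4 : Tendsto (fun k => (σ k : ℝ) * (1 / 2)) atTop atTop :=
      (tendsto_natCast_atTop_atTop.comp hσ.tendsto_atTop).atTop_mul_const (by norm_num)
    refine h4.congr fun k => ?_
    simp
  · have h1 := hcd {0} (singleton_subset_iff.2 h0d) isCompact_singleton {0}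
      (singleton_subset_iff.2 (hD 0 rfl)) isCompact_singleton
    obtain ⟨k, hk⟩ := h1.exists
    simp at hk

end Lempert

theorem lemma13 (n : ℕ) (hn : 2 ≤ n) (α : Fin n → ℕ) (hpos : ∀ j, 0 < α j)
    (hcop : Finset.univ.gcd α = 1) (w z : Fin n → ℂ)
    (hw : w ∈ Lempert.reinhardtDomainStar α) (hz : z ∈ Lempert.reinhardtDomainStar α)
    (hwz : Lempert.monomial α w ≠ Lempert.monomial α z) :
    (∃ φ : ℂ → Fin n → ℂ,
      Lempert.IsLempertGeodesic (Lempert.reinhardtDomain α) w z φ ∧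
        Bornology.IsBounded (φ '' Lempert.unitDisc)) ∧
      ¬ Lempert.IsTaut (Lempert.reinhardtDomain α) := by
  open Lempert in
  refine ⟨?_, not_isTaut_reinhardtDomain hn hpos⟩
  have hne : ∀ {v : Fin n → ℂ}, v ∈ reinhardtDomainStar α → ∀ j, v j ≠ 0 := fun hv j =>
    Finset.prod_ne_zero_iff.1 hv.2 j (Finset.mem_univ j)
  have hne' : ∀ {v : Fin n → ℂ}, v ∈ reinhardtDomainStar α → monomial α v ≠ 0 := fun hv =>
    Finset.prod_ne_zero_iff.2 fun j _ => pow_ne_zero _ (hne hv j)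
  have hlt : ∀ {v : Fin n → ℂ}, v ∈ reinhardtDomainStar α → ‖monomial α v‖ < 1 := fun hv => by
    rw [norm_monomial]; exact hv.1
  obtain ⟨s, b, c, P, Q, h, h0, h1, hmin⟩ :=
    exists_minimal_pickData α (hne' hw) (hne' hz) (hlt hw) (hlt hz) hwz
  obtain ⟨φ, hφ, hφ0, hφs, hbdd⟩ :=
    h.exists_bounded_disc hpos hcop (hne' hw) (hne' hz) hwz h0 h1
  have h0d : (0 : ℂ) ∈ unitDisc := by simp [mem_unitDisc]
  have hsd : (s : ℂ) ∈ unitDisc := by simp [mem_unitDisc, abs_of_pos h0, h1]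
  have hm : mobiusDist 0 s = s := by simp [mobiusDist, abs_of_pos h0]
  refine ⟨φ, ⟨fun e => hwz (by rw [e]), hφ, 0, h0d, s, hsd, hφ0, hφs, ?_⟩, hbdd⟩
  have hleast : IsLeast {r : ℝ | ∃ a ∈ unitDisc, ∃ b ∈ unitDisc, r = mobiusDist a b ∧
      ∃ φ : ℂ → Fin n → ℂ, IsAnalyticDisc (reinhardtDomain α) φ ∧ φ a = w ∧ φ b = z} s := by
    refine ⟨⟨0, h0d, s, hsd, hm.symm, φ, hφ, hφ0, hφs⟩, ?_⟩
    rintro _ ⟨p, hp, q, hq, rfl, χ, hχ, rfl, rfl⟩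
    refine le_mobiusDist_of_forall_div (mem_unitDisc.1 hp) (mem_unitDisc.1 hq)
      fun ρ hρ hpρ hqρ => ?_
    obtain ⟨B, C, P', Q', h'⟩ := exists_pickData_of_isAnalyticDisc hχ hρ hpρ hqρ (hne hw)
    exact hmin _ _ _ _ _ h'
  rw [hm]
  exact hleast.csInf_eq.symm
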